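/- Let $T=\mathbb R/2\pi\mathbb Z$, let $C(T)$ be the space of continuous complex-valued functions on $T$ with the norm $\|f\|=\max_{x\in T}|f(x)|$, and let $T_n$ be the space of trigonometric polynomials $\sum_{j=-n}^{n}c_je^{ijt}$ of degree at most $n$ with complex coefficients. For $f\in C(T)$ put $$E_n(f)=\inf_{\tau\in T_n}\|f-\tau\|,\qquad \Delta_h^m f(x)=\sum_{i=0}^m(-1)^{m-i}\binom mi f\bigl(x-\tfrac m2h+ih\bigr),\qquad \omega_m(f,\delta)=\sup_{x\in T,\ |h|<\delta}|\Delta_h^mf(x)|.$$ **Theorem 1.** Let $\alpha=2^{-5/2}\,3^{1/2}\,\pi$. Then $\alpha<1$, and for every $f\in C(T)$ and all integers $k\ge 1$ and $n\ge 2k$, $$E_n(f)\le \frac{2(k+1)^2}{\binom{2k}{k}}\;\omega_{2k}\Bigl(f,\ \frac{2\pi}{n}\,\alpha\,\Bigl(1+\frac1k\Bigr)\Bigr).$$ The constant in this Jackson–Stechkin inequality decays exponentially in $k$: there is a real number $C$ such that $\frac{2(k+1)^2}{\binom{2k}{k}}\le C\,k^{5/2}\,2^{-2k}$ for all integers $k\ge1$.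 -/

import Mathlib

noncomputable section

/-- The circle `T = ℝ / 2πℤ`. -/
abbrev Circ : Type := AddCircle (2 * Real.pi)

instance circFact : Fact (0 < 2 * Real.pi) := ⟨Real.two_pi_pos⟩

/-- `T_n`: the space of trigonometric polynomials `∑_{|j| ≤ n} c_j e^{ijt}` of degree at most `n`,
as a subspace of `C(T)` (here `fourier j` is the character `t ↦ e^{ijt}`). -/
def trigPoly (n : ℕ) : Submodule ℂ C(Circ, ℂ) :=
  Submodule.span ℂ {g | ∃ j : ℤ, |j| ≤ (n : ℤ) ∧ g = fourier j}

/-- `E_n(f) = inf_{τ ∈ T_n} ‖f - τ‖`, the norm of `C(T)` being the maximum norm. -/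
def bestApprox (n : ℕ) (f : C(Circ, ℂ)) : ℝ :=
  ⨅ τ : trigPoly n, ‖f - (τ : C(Circ, ℂ))‖

/-- The symmetric difference
`Δ_h^m f(x) = ∑_{i=0}^m (-1)^{m-i} (m choose i) f(x - (m/2) h + i h)`. -/
def symmDifference (m : ℕ) (h : ℝ) (f : C(Circ, ℂ)) (x : Circ) : ℂ :=
  ∑ i ∈ Finset.range (m + 1),
    (-1 : ℂ) ^ (m - i) * (m.choose i : ℂ) *
      f (x + ((-((m : ℝ) / 2) * h + (i : ℝ) * h : ℝ) : Circ))

/-- The modulus of smoothness `ω_m(f, δ) = sup_{x, |h| < δ} |Δ_h^m f(x)|`. -/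
def smoothnessModulus (m : ℕ) (f : C(Circ, ℂ)) (δ : ℝ) : ℝ :=
  sSup {r : ℝ | ∃ (x : Circ) (h : ℝ), |h| < δ ∧ r = ‖symmDifference m h f x‖}

/-- The number `2^{-5/2} 3^{1/2} π`. -/
def alphaConst : ℝ := (2 : ℝ) ^ (-(5 : ℝ) / 2) * (3 : ℝ) ^ ((1 : ℝ) / 2) * Real.pi

/-- The constant `2 (k+1)^2 / (2k choose k)`. -/
def jacksonConst (k : ℕ) : ℝ := 2 * ((k : ℝ) + 1) ^ 2 / ((2 * k).choose k : ℝ)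

end

open MeasureTheory AddCircle Filter Topology

noncomputable section

/-! Divide the symmetric difference of order `2k` by its central coefficient, up to sign, so that
the unshifted term is `f` itself, and average over steps `t` in `(0, h)` with a triangular weight.
The result has norm at most `ω / (2k choose k)`. At frequency `j ≠ 0` it multiplies by `1` minus a
combination of the terms `(1 - cos(j(i+1)h)) / j²`. Beyond degree `n` the subtracted part is a
combination of translates of a multiplier equal to `1/j²`. A positive sum of Fejér kernels realizes
that multiplier with norm at most `3/n²`, so the subtracted part is an operator of norm at most
`32/(hn)²` (`norm_smoothPart_le`, `norm_invSqMultiplier_le`). Applying this operator to `f - τ`,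
with `τ` of degree at most `n`, leaves an error of degree at most `n`
(`sub_averagedDiff_sub_smoothPart_mem`). Hence `E ≤ ω / (2k choose k) + 32/(hn)² · E` for `E =
E_n(f)`. The given `h` makes the factor of `E` less than `1`, and solving for `E` gives the theorem.
-/

/-! ### Translations, Fourier coefficients and trigonometric polynomials. -/

/-- The translate `x ↦ f (x + t)`. -/
def shiftBy (t : Circ) (f : C(Circ, ℂ)) : C(Circ, ℂ) :=
  f.comp (ContinuousMap.addRight t)

@[simp]
lemma shiftBy_apply (t : Circ) (f : C(Circ, ℂ)) (x : Circ) : shiftBy t f x = f (x + t) := rfl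

lemma continuous_shiftBy (f : C(Circ, ℂ)) : Continuous fun t => shiftBy t f := by
  refine ContinuousMap.continuous_of_continuous_uncurry _ ?_
  change Continuous fun p : Circ × Circ => f (p.2 + p.1)
  fun_prop

lemma norm_shiftBy_le (t : Circ) (f : C(Circ, ℂ)) : ‖shiftBy t f‖ ≤ ‖f‖ :=
  (ContinuousMap.norm_le _ (norm_nonneg _)).2 fun x => f.norm_coe_le_norm (x + t)

lemma integrable_circle {E : Type*} [NormedAddCommGroup E] {g : Circ → E} (hg : Continuous g) :
    Integrable g haarAddCircle :=
  hg.integrable_of_hasCompactSupport (HasCompactSupport.of_compactSpace _)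

/-- The `j`-th Fourier coefficient as a continuous linear functional on `C(T)`. -/
def coeffFunctional (j : ℤ) : C(Circ, ℂ) →L[ℂ] ℂ :=
  LinearMap.mkContinuous
    { toFun := fun f => fourierCoeff (f : Circ → ℂ) j
      map_add' := fun f g => congrFun (fourierCoeff.add (integrable_circle f.continuous)
        (integrable_circle g.continuous)) j
      map_smul' := fun c f => fourierCoeff.const_smul (f : Circ → ℂ) c j } 1
    (fun f => by
      change ‖fourierCoeff (f : Circ → ℂ) j‖ ≤ _
      rw [fourierCoeff]
      refine (norm_integral_le_of_norm_le_const (C := 1 * ‖f‖) (.of_forall fun t => ?_)).trans ?_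
      · rw [norm_smul]
        refine mul_le_mul ?_ (f.norm_coe_le_norm t) (norm_nonneg _) zero_le_one
        exact ((fourier (-j)).norm_coe_le_norm t).trans (fourier_norm _).le
      · simp)

lemma coeffFunctional_apply (j : ℤ) (f : C(Circ, ℂ)) :
    coeffFunctional j f = fourierCoeff (f : Circ → ℂ) j := rfl

lemma fourier_add_arg (j : ℤ) (s t : Circ) :
    (fourier j (s + t) : ℂ) = fourier j s * fourier j t := by
  simp [fourier_apply, smul_add, toCircle_add]

lemma coeffFunctional_shiftBy (j : ℤ) (t : Circ) (f : C(Circ, ℂ)) :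
    coeffFunctional j (shiftBy t f) = fourier j t * coeffFunctional j f := by
  simp only [coeffFunctional_apply, fourierCoeff, shiftBy_apply, smul_eq_mul]
  rw [← integral_add_right_eq_self (fun x => fourier (-j) x * f x) t, ← integral_const_mul]
  refine integral_congr_ae (.of_forall fun x => ?_)
  have h : (fourier j t : ℂ) * fourier (-j) t = 1 := by
    rw [← fourier_add]; simp
  simp only [fourier_add_arg]
  linear_combination (-(fourier (-j) x : ℂ) * f (x + t)) * h

lemma integral_fourier (j : ℤ) :
    ∫ t : Circ, (fourier j t : ℂ) ∂haarAddCircle = if j = 0 then 1 else 0 := by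
  have h := congrFun (fourierCoeff_fourier (T := 2 * Real.pi) j) 0
  simpa [fourierCoeff, Pi.single_apply, eq_comm] using h

lemma fourier_mem_trigPoly {n : ℕ} {j : ℤ} (hj : |j| ≤ n) : fourier j ∈ trigPoly n :=
  Submodule.subset_span ⟨j, hj, rfl⟩

/-- Finitely many coefficients survive, so the Fourier series is summable and its finite sum is `f`.
-/
lemma mem_trigPoly_of_coeffFunctional_eq_zero {n : ℕ} {f : C(Circ, ℂ)}
    (hf : ∀ j : ℤ, (n : ℤ) < |j| → coeffFunctional j f = 0) : f ∈ trigPoly n := by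
  have h0 : ∀ j ∉ Finset.Icc (-(n : ℤ)) n, fourierCoeff (f : Circ → ℂ) j = 0 := by
    intro j hj
    refine hf j ?_
    rw [Finset.mem_Icc, ← abs_le] at hj
    omega
  have hs := hasSum_fourier_series_of_summable (f := f) (summable_of_ne_finset_zero h0)
  rw [hs.unique (hasSum_sum_of_ne_finset_zero fun j hj => by rw [h0 j hj, zero_smul])]
  refine Submodule.sum_mem _ fun j hj => Submodule.smul_mem _ _ (fourier_mem_trigPoly ?_)
  rwa [Finset.mem_Icc, ← abs_le] at hj

lemma coeffFunctional_eq_zero_of_mem_trigPoly {n : ℕ} {f : C(Circ, ℂ)} (hf : f ∈ trigPoly n)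
    {j : ℤ} (hj : (n : ℤ) < |j|) : coeffFunctional j f = 0 := by
  refine Submodule.span_induction ?_ (map_zero _) (fun f g _ _ hf hg => ?_)
    (fun c f _ hf => ?_) hf
  · rintro _ ⟨i, hi, rfl⟩
    rw [coeffFunctional_apply, fourierCoeff_fourier, Pi.single_eq_of_ne]
    rintro rfl
    omega
  · rw [map_add, hf, hg, add_zero]
  · rw [map_smul, hf, smul_zero]

/-! ### Fejér kernels and means. -/

/-- `M` times the Fejér kernel of order `M`. -/
def fejerSq (M : ℕ) (t : Circ) : ℝ := ‖∑ a ∈ Finset.range M, (fourier (a : ℤ) t : ℂ)‖ ^ 2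

lemma fejerSq_nonneg (M : ℕ) (t : Circ) : 0 ≤ fejerSq M t := sq_nonneg _

lemma continuous_fejerSq (M : ℕ) : Continuous (fejerSq M) := by
  unfold fejerSq
  fun_prop

lemma fejerSq_eq (M : ℕ) (t : Circ) :
    (fejerSq M t : ℂ) = ∑ a ∈ Finset.range M, ∑ b ∈ Finset.range M,
      (fourier ((a : ℤ) - b) t : ℂ) := by
  rw [fejerSq, Complex.ofReal_pow, ← Complex.mul_conj', map_sum, Finset.sum_mul_sum]
  simp only [sub_eq_add_neg, fourier_add, fourier_neg]

lemma card_pairs_sub_eq (M : ℕ) (j : ℤ) :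
    (∑ a ∈ Finset.range M, ∑ b ∈ Finset.range M, if (a : ℤ) - b + j = 0 then (1 : ℂ) else 0)
      = ((M - j.natAbs : ℕ) : ℂ) := by
  obtain ⟨n, rfl | rfl⟩ := j.eq_nat_or_neg
  · have (a : ℕ) (b : ℕ) : (a : ℤ) - b + n = 0 ↔ b = a + n := by omega
    simp only [this, Finset.sum_ite_eq', Finset.mem_range]
    rw [Finset.sum_boole]
    congr 2
    rw [Int.natAbs_natCast, ← Finset.card_range (M - n)]
    congr 1
    ext a
    simp only [Finset.mem_filter, Finset.mem_range]
    omega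
  · rw [Finset.sum_comm]
    have (a : ℕ) (b : ℕ) : (a : ℤ) - b + -n = 0 ↔ a = b + n := by omega
    simp only [this, Finset.sum_ite_eq', Finset.mem_range]
    rw [Finset.sum_boole]
    congr 2
    rw [Int.natAbs_neg, Int.natAbs_natCast, ← Finset.card_range (M - n)]
    congr 1
    ext a
    simp only [Finset.mem_filter, Finset.mem_range]
    omega

/-- Orthogonality leaves the number of pairs `a, b < M` with `a - b = -j`. The truncated subtraction
is the positive part of `M - |j|`. -/
lemma integral_fejerSq_mul_fourier (M : ℕ) (j : ℤ) :
    ∫ t : Circ, (fejerSq M t : ℂ) * fourier j t ∂haarAddCircle = ((M - j.natAbs : ℕ) : ℂ) := by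
  simp only [fejerSq_eq, Finset.sum_mul, ← fourier_add]
  rw [integral_finsetSum _ fun a _ => integrable_circle (by fun_prop)]
  rw [← card_pairs_sub_eq]
  refine Finset.sum_congr rfl fun a _ => ?_
  rw [integral_finsetSum _ fun b _ => integrable_circle (by fun_prop)]
  exact Finset.sum_congr rfl fun b _ => integral_fourier _

/-- `M` times the Fejér mean of order `M`. -/
def fejerMean (M : ℕ) (f : C(Circ, ℂ)) : C(Circ, ℂ) :=
  ∫ t : Circ, (fejerSq M t : ℂ) • shiftBy t f ∂haarAddCircle

lemma norm_fejerMean_le (M : ℕ) (f : C(Circ, ℂ)) : ‖fejerMean M f‖ ≤ M * ‖f‖ := by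
  have hM : ∫ t : Circ, fejerSq M t ∂haarAddCircle = M := by
    have h := integral_fejerSq_mul_fourier M 0
    simp only [fourier_zero, mul_one, Int.natAbs_zero, Nat.sub_zero] at h
    rw [integral_complex_ofReal] at h
    exact_mod_cast h
  rw [← hM, ← integral_mul_const]
  refine norm_integral_le_of_norm_le
    (integrable_circle ((continuous_fejerSq M).mul continuous_const)) (.of_forall fun t => ?_)
  rw [norm_smul, Complex.norm_real, Real.norm_of_nonneg (fejerSq_nonneg M t)]
  exact mul_le_mul_of_nonneg_left (norm_shiftBy_le t f) (fejerSq_nonneg M t)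

lemma coeffFunctional_fejerMean (M : ℕ) (f : C(Circ, ℂ)) (j : ℤ) :
    coeffFunctional j (fejerMean M f) = ((M - j.natAbs : ℕ) : ℂ) * coeffFunctional j f := by
  have hc : Continuous fun t : Circ => (fejerSq M t : ℂ) • shiftBy t f :=
    (Complex.continuous_ofReal.comp (continuous_fejerSq M)).smul (continuous_shiftBy f)
  rw [fejerMean, ← ContinuousLinearMap.integral_comp_comm _ (integrable_circle hc),
    ← integral_fejerSq_mul_fourier, ← integral_mul_const]
  refine integral_congr_ae (.of_forall fun t => ?_)
  simp only [map_smul, coeffFunctional_shiftBy, smul_eq_mul, mul_assoc]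

/-! ### The multiplier `1/j²` as a positive sum of Fejér means. -/

/-- The sequence `1 / M ^ 2`. -/
def invSq (M : ℕ) : ℝ := 1 / (M : ℝ) ^ 2

lemma invSq_anti {M N : ℕ} (hM : 0 < M) (h : M ≤ N) : invSq N ≤ invSq M := by
  have : (0 : ℝ) < M := by exact_mod_cast hM
  unfold invSq
  gcongr

/-- The second difference of `invSq` centred at `M + 2`. -/
def invSqSecondDiff (M : ℕ) : ℝ := invSq (M + 1) - 2 * invSq (M + 2) + invSq (M + 3)

lemma invSqSecondDiff_nonneg (M : ℕ) : 0 ≤ invSqSecondDiff M := by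
  have : invSqSecondDiff M = (6 * ((M : ℝ) + 2) ^ 2 - 2) /
      (((M : ℝ) + 1) ^ 2 * ((M : ℝ) + 2) ^ 2 * ((M : ℝ) + 3) ^ 2) := by
    unfold invSqSecondDiff invSq
    push_cast
    field_simp
    ring
  rw [this]
  have h : (0 : ℝ) ≤ M := M.cast_nonneg
  exact div_nonneg (by nlinarith) (by positivity)

/-- The remainder after summation by parts in `∑ (M - j)₊ * invSqSecondDiff`. -/
def abelTail (j M : ℕ) : ℝ :=
  ((M + 2 - j : ℕ) : ℝ) * (invSq (M + 1) - invSq (M + 2)) + invSq (max (M + 2) j)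

/-- As a function of `j`, `abelTail j M` follows `1/j²` for `j ≥ M + 1` and, below that, the chord
through the nodes `M + 1` and `M + 2`. Moving to the next chord changes it by a hinge function at `M
+ 2`, scaled by the second difference. -/
lemma abelTail_sub_succ (j M : ℕ) :
    abelTail j M - abelTail j (M + 1) = invSqSecondDiff M * ((M + 2 - j : ℕ) : ℝ) := by
  unfold abelTail invSqSecondDiff
  rcases lt_trichotomy j (M + 3) with h | rfl | h
  · obtain ⟨d, hd⟩ : ∃ d, M + 2 = j + d := ⟨M + 2 - j, by omega⟩
    have h1 : M + 2 - j = d := by omega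
    have h2 : M + 1 + 2 - j = d + 1 := by omega
    rw [max_eq_left (by omega), max_eq_left (by omega), h1, h2]
    push_cast
    ring_nf
  · have h1 : M + 2 - (M + 3) = 0 := by omega
    have h2 : M + 1 + 2 - (M + 3) = 0 := by omega
    rw [max_eq_right (by omega), max_eq_right (by omega), h1, h2]
    simp
  · have h1 : M + 2 - j = 0 := by omega
    have h2 : M + 1 + 2 - j = 0 := by omega
    rw [max_eq_right (by omega), max_eq_right (by omega), h1, h2]
    simp

lemma abelTail_nonneg (j M : ℕ) : 0 ≤ abelTail j M :=
  add_nonneg (mul_nonneg (Nat.cast_nonneg _) (sub_nonneg.2 (invSq_anti (by omega) (by omega))))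
    (by unfold invSq; positivity)

lemma abelTail_le (j M : ℕ) : abelTail j M ≤ 3 / ((M : ℝ) + 1) ^ 2 := by
  have h0 : 0 ≤ invSq (M + 1) - invSq (M + 2) := sub_nonneg.2 (invSq_anti (by omega) (by omega))
  have h1 : ((M + 2 - j : ℕ) : ℝ) ≤ (M : ℝ) + 2 := by
    exact_mod_cast (Nat.sub_le (M + 2) j)
  have h2 : invSq (max (M + 2) j) ≤ 1 / ((M : ℝ) + 1) ^ 2 := by
    have := invSq_anti (M := M + 1) (N := max (M + 2) j) (by omega) (by omega)
    simpa [invSq] using this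
  -- The chord has slope of order `2/M³` over a length of order `M`, contributing `2`; the value at
  -- the node contributes `1` to the constant `3`.
  have h3 : ((M : ℝ) + 2) * (invSq (M + 1) - invSq (M + 2)) ≤ 2 / ((M : ℝ) + 1) ^ 2 := by
    have : ((M : ℝ) + 2) * (invSq (M + 1) - invSq (M + 2)) =
        ((2 * M + 3) / (M + 2)) / ((M : ℝ) + 1) ^ 2 := by
      unfold invSq
      push_cast
      field_simp
      ring
    rw [this]
    have hM : (0 : ℝ) ≤ M := M.cast_nonneg
    gcongr
    rw [div_le_iff₀ (by positivity)]
    linarith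
  have h4 := mul_le_mul_of_nonneg_right h1 h0
  have h5 : 2 / ((M : ℝ) + 1) ^ 2 + 1 / ((M : ℝ) + 1) ^ 2 = 3 / ((M : ℝ) + 1) ^ 2 := by ring
  unfold abelTail
  linarith

lemma tendsto_abelTail (j n : ℕ) : Tendsto (fun m => abelTail j (m + n)) atTop (𝓝 0) := by
  have hlim : Tendsto (fun m : ℕ => 3 * (1 / ((m : ℝ) + 1))) atTop (𝓝 0) := by
    simpa using (tendsto_one_div_add_atTop_nhds_zero_nat (𝕜 := ℝ)).const_mul 3
  refine squeeze_zero (fun m => abelTail_nonneg _ _) (fun m => (abelTail_le _ _).trans ?_) hlim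
  rw [← mul_one_div]
  gcongr
  have h1 : (0 : ℝ) ≤ m := m.cast_nonneg
  have h2 : (0 : ℝ) ≤ n := n.cast_nonneg
  push_cast
  nlinarith [mul_nonneg h1 h2]

lemma hasSum_invSqSecondDiff (j n : ℕ) :
    HasSum (fun m => invSqSecondDiff (m + n) * ((m + n + 2 - j : ℕ) : ℝ)) (abelTail j n) := by
  rw [hasSum_iff_tendsto_nat_of_nonneg
    fun m => mul_nonneg (invSqSecondDiff_nonneg _) (Nat.cast_nonneg _)]
  have h (L : ℕ) : ∑ m ∈ Finset.range L, invSqSecondDiff (m + n) * ((m + n + 2 - j : ℕ) : ℝ)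
      = abelTail j n - abelTail j (L + n) := by
    have := Finset.sum_range_sub' (fun m => abelTail j (m + n)) L
    rw [zero_add] at this
    rw [← this]
    refine Finset.sum_congr rfl fun m _ => ?_
    rw [← abelTail_sub_succ, Nat.add_right_comm]
  simp only [h]
  simpa using (tendsto_abelTail j n).const_sub (abelTail j n)

/-- A positive convolution operator acting on the frequencies `|j| > n` as division by `j ^ 2`. -/
def invSqMultiplier (n : ℕ) (f : C(Circ, ℂ)) : C(Circ, ℂ) :=
  ∑' m, (invSqSecondDiff (m + n) : ℂ) • fejerMean (m + n + 2) f

lemma hasSum_norm_bound (n : ℕ) (f : C(Circ, ℂ)) :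
    HasSum (fun m => invSqSecondDiff (m + n) * ((m + n + 2 : ℕ) : ℝ) * ‖f‖)
      (abelTail 0 n * ‖f‖) :=
  (hasSum_invSqSecondDiff 0 n).mul_right ‖f‖

lemma norm_invSqSecondDiff_smul_le (m n : ℕ) (f : C(Circ, ℂ)) :
    ‖(invSqSecondDiff (m + n) : ℂ) • fejerMean (m + n + 2) f‖ ≤
      invSqSecondDiff (m + n) * ((m + n + 2 : ℕ) : ℝ) * ‖f‖ := by
  rw [norm_smul, Complex.norm_real, Real.norm_of_nonneg (invSqSecondDiff_nonneg _), mul_assoc]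
  exact mul_le_mul_of_nonneg_left (norm_fejerMean_le _ f) (invSqSecondDiff_nonneg _)

/-- Convexity of `1/M²` makes all weights nonnegative, so the norm is bounded by the total mass,
which is the value `abelTail 0 n` at frequency zero. -/
lemma norm_invSqMultiplier_le {n : ℕ} (hn : 0 < n) (f : C(Circ, ℂ)) :
    ‖invSqMultiplier n f‖ ≤ 3 / (n : ℝ) ^ 2 * ‖f‖ := by
  refine (tsum_of_norm_bounded (hasSum_norm_bound n f)
    fun m => norm_invSqSecondDiff_smul_le m n f).trans ?_
  refine mul_le_mul_of_nonneg_right ((abelTail_le 0 n).trans ?_) (norm_nonneg f)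
  have : (0 : ℝ) < n := by exact_mod_cast hn
  gcongr
  linarith

lemma coeffFunctional_invSqMultiplier {n : ℕ} (f : C(Circ, ℂ)) {j : ℤ} (hj : (n : ℤ) < |j|) :
    coeffFunctional j (invSqMultiplier n f) = 1 / (j : ℂ) ^ 2 * coeffFunctional j f := by
  have hs : Summable fun m => (invSqSecondDiff (m + n) : ℂ) • fejerMean (m + n + 2) f :=
    .of_norm_bounded (hasSum_norm_bound n f).summable
      fun m => norm_invSqSecondDiff_smul_le m n f
  have hj' : n + 1 ≤ j.natAbs := by
    rw [Int.abs_eq_natAbs] at hj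
    omega
  have hv : abelTail j.natAbs n = 1 / (j : ℝ) ^ 2 := by
    have hsq : ((j.natAbs : ℕ) : ℝ) ^ 2 = (j : ℝ) ^ 2 := by
      rw [Nat.cast_natAbs, Int.cast_abs, sq_abs]
    rw [← hsq]
    unfold abelTail
    -- At `|j| = n + 1` the chord is evaluated at its left node; beyond it only the `1/j²` branch
    -- remains.
    rcases hj'.eq_or_lt with h | h
    · rw [← h, max_eq_left (by omega), show n + 2 - (n + 1) = 1 by omega]
      simp [invSq]
    · rw [max_eq_right (by omega), show n + 2 - j.natAbs = 0 by omega]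
      simp [invSq]
  have h1 := (hasSum_invSqSecondDiff j.natAbs n)
  rw [hv] at h1
  have h2 := (Complex.hasSum_ofReal.2 h1).mul_right (coeffFunctional j f)
  have h3 := (coeffFunctional j).hasSum hs.hasSum
  have e (m : ℕ) : coeffFunctional j ((invSqSecondDiff (m + n) : ℂ) • fejerMean (m + n + 2) f) =
      ((invSqSecondDiff (m + n) * ((m + n + 2 - j.natAbs : ℕ) : ℝ) : ℝ) : ℂ) *
        coeffFunctional j f := by
    rw [map_smul, coeffFunctional_fejerMean, smul_eq_mul]
    push_cast
    ring
  simp only [e] at h3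
  rw [invSqMultiplier, h3.unique h2]
  push_cast
  rfl

/-! ### Numerical constants and the central binomial coefficient. -/

lemma alphaConst_pos : 0 < alphaConst := by
  unfold alphaConst
  positivity

lemma alphaConst_sq : alphaConst ^ 2 = 3 * Real.pi ^ 2 / 32 := by
  have h1 : ((2 : ℝ) ^ (-(5 : ℝ) / 2)) ^ 2 = 1 / 32 := by
    rw [← Real.rpow_natCast, ← Real.rpow_mul (by norm_num)]
    norm_num
  have h2 : ((3 : ℝ) ^ ((1 : ℝ) / 2)) ^ 2 = 3 := by
    rw [← Real.rpow_natCast, ← Real.rpow_mul (by norm_num)]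
    norm_num
  rw [alphaConst, mul_pow, mul_pow, h1, h2]
  ring

lemma alphaConst_lt_one : alphaConst < 1 := by
  have := alphaConst_sq
  nlinarith [Real.pi_lt_d2, Real.pi_pos, alphaConst_pos]

/-- Equality holds at `k = 1`; the induction step comes down to `4k(k+1) ≤ (2k+1)²`. -/
lemma sixteen_pow_le_centralBinom {k : ℕ} (hk : 1 ≤ k) :
    (16 : ℝ) ^ k ≤ 4 * k * (k.centralBinom : ℝ) ^ 2 := by
  induction k, hk using Nat.le_induction with
  | base => norm_num [Nat.centralBinom]
  | succ k hk ih =>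
    have h : ((k : ℝ) + 1) * ((k + 1).centralBinom : ℝ) =
        2 * (2 * k + 1) * (k.centralBinom : ℝ) := by
      exact_mod_cast Nat.succ_mul_centralBinom_succ k
    have hk0 : (0 : ℝ) < (k : ℝ) + 1 := by positivity
    refine le_of_mul_le_mul_left ?_ hk0
    have e : ((k : ℝ) + 1) * (4 * ((k + 1 : ℕ) : ℝ) * ((k + 1).centralBinom : ℝ) ^ 2) =
        16 * (2 * k + 1) ^ 2 * (k.centralBinom : ℝ) ^ 2 := by
      push_cast
      linear_combination 4 * (((k : ℝ) + 1) * ((k + 1).centralBinom : ℝ) +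
        2 * (2 * k + 1) * (k.centralBinom : ℝ)) * h
    rw [e, pow_succ]
    have h2 := mul_le_mul_of_nonneg_left ih hk0.le
    nlinarith [sq_nonneg (k.centralBinom : ℝ)]

/-- The constant is `16 = 8 · 2`: `2(k+1)² ≤ 8k²`, and the reciprocal of the central binomial
coefficient is at most `2√k / 4^k`. -/
lemma jacksonConst_le {k : ℕ} (hk : 1 ≤ k) :
    jacksonConst k ≤ 16 * (k : ℝ) ^ ((5 : ℝ) / 2) * (2 : ℝ) ^ (-(2 * (k : ℝ))) := by
  have hk1 : (1 : ℝ) ≤ k := by exact_mod_cast hk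
  have hk0 : (0 : ℝ) < k := by linarith
  have hB : (0 : ℝ) < ((2 * k).choose k : ℝ) := by
    exact_mod_cast Nat.choose_pos (by omega)
  have h4 : (2 : ℝ) ^ (-(2 * (k : ℝ))) = ((4 : ℝ) ^ k)⁻¹ := by
    rw [Real.rpow_neg (by norm_num), Real.rpow_mul (by norm_num), Real.rpow_natCast]
    norm_num
  have h5 : (k : ℝ) ^ ((5 : ℝ) / 2) = (k : ℝ) ^ 2 * √k := by
    rw [show (5 : ℝ) / 2 = (2 : ℕ) + 1 / 2 by norm_num, Real.rpow_add hk0, Real.rpow_natCast,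
      Real.sqrt_eq_rpow]
  have hs : (4 : ℝ) ^ k ≤ 2 * √k * ((2 * k).choose k : ℝ) := by
    refine le_of_sq_le_sq ?_ (by positivity)
    have := sixteen_pow_le_centralBinom hk
    rw [Nat.centralBinom] at this
    rw [mul_pow, mul_pow, Real.sq_sqrt hk0.le, ← pow_mul, mul_comm k 2, pow_mul]
    norm_num
    linarith
  rw [jacksonConst, h4, h5, div_le_iff₀ hB]
  have : 16 * ((k : ℝ) ^ 2 * √k) * ((4 : ℝ) ^ k)⁻¹ * ((2 * k).choose k : ℝ) =
      8 * (k : ℝ) ^ 2 * ((2 * √k * ((2 * k).choose k : ℝ)) / 4 ^ k) := by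
    field_simp
    ring
  rw [this]
  have h6 : 1 ≤ (2 * √k * ((2 * k).choose k : ℝ)) / 4 ^ k := by
    rwa [one_le_div (by positivity)]
  nlinarith [mul_le_mul_of_nonneg_left h6 (by positivity : 0 ≤ 8 * (k : ℝ) ^ 2)]

/-! ### Bounds for the binomial weights. -/

/-- The coefficients `(2k choose k+i) / ((2k choose k) i ^ 2)`, with `i` shifted by one. -/
def diffWeight (k i : ℕ) : ℝ :=
  ((2 * k).choose (k + i + 1) : ℝ) / ((2 * k).choose k : ℝ) / ((i : ℝ) + 1) ^ 2

lemma diffWeight_nonneg (k i : ℕ) : 0 ≤ diffWeight k i := by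
  unfold diffWeight
  positivity

lemma diffWeight_le (k i : ℕ) : diffWeight k i ≤ 1 / ((i : ℝ) + 1) ^ 2 := by
  unfold diffWeight
  gcongr
  refine div_le_one_of_le₀ ?_ (Nat.cast_nonneg _)
  have := Nat.choose_le_centralBinom (k + i + 1) k
  exact_mod_cast this

lemma antitone_diffWeight (k : ℕ) : Antitone (diffWeight k) := by
  refine antitone_nat_of_succ_le fun i => ?_
  unfold diffWeight
  have h : (2 * k).choose (k + (i + 1) + 1) ≤ (2 * k).choose (k + i + 1) := by
    have := Nat.choose_succ_right_eq (2 * k) (k + i + 1)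
    refine Nat.le_of_mul_le_mul_right (?_ : _ * (k + i + 1 + 1) ≤ _) (by omega)
    rw [show k + (i + 1) + 1 = k + i + 1 + 1 by omega, this]
    exact Nat.mul_le_mul_left _ (by omega)
  have h' : ((2 * k).choose (k + (i + 1) + 1) : ℝ) ≤ ((2 * k).choose (k + i + 1) : ℝ) := by
    exact_mod_cast h
  push_cast
  gcongr
  linarith

lemma alternating_sum_bounds {b : ℕ → ℝ} (hb : Antitone b) (h0 : ∀ i, 0 ≤ b i) (k : ℕ) :
    0 ≤ ∑ i ∈ Finset.range k, (-1) ^ i * b i ∧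
      ∑ i ∈ Finset.range k, (-1) ^ i * b i ≤ b 0 := by
  induction k generalizing b with
  | zero => simp [h0]
  | succ k ih =>
    have h := ih (b := fun i => b (i + 1)) (fun _ _ h => hb (by omega)) fun i => h0 _
    have e : ∑ i ∈ Finset.range k, (-1) ^ (i + 1) * b (i + 1) =
        -∑ i ∈ Finset.range k, (-1) ^ i * b (i + 1) := by
      rw [← Finset.sum_neg_distrib]
      exact Finset.sum_congr rfl fun i _ => by ring
    rw [Finset.sum_range_succ', e]
    have := hb (zero_le_one : 0 ≤ 1)
    simp only [zero_add, pow_zero, one_mul] at h ⊢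
    constructor <;> linarith

/-- Telescoping from `1/(k+2)² ≤ 1/((k+2)² - 1/4)`, with equality at the first partial sum in the
sharpened form. -/
lemma sum_one_div_sq_le (k : ℕ) :
    ∑ i ∈ Finset.range k, 1 / ((i : ℝ) + 1) ^ 2 ≤ 5 / 3 := by
  have h (k : ℕ) : ∑ i ∈ Finset.range (k + 1), 1 / ((i : ℝ) + 1) ^ 2 ≤
      5 / 3 - 1 / ((k : ℝ) + 3 / 2) := by
    induction k with
    | zero => norm_num
    | succ k ih =>
      rw [Finset.sum_range_succ]
      have : 1 / (((k + 1 : ℕ) : ℝ) + 1) ^ 2 ≤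
          1 / ((k : ℝ) + 3 / 2) - 1 / (((k + 1 : ℕ) : ℝ) + 3 / 2) := by
        rw [div_sub_div _ _ (by positivity) (by positivity),
          div_le_div_iff₀ (by positivity) (by positivity)]
        push_cast
        nlinarith
      linarith
  refine (Finset.sum_le_sum_of_subset_of_nonneg (Finset.range_subset_range.2 k.le_succ)
    fun i _ _ => by positivity).trans ((h k).trans ?_)
  have : (0 : ℝ) ≤ 1 / ((k : ℝ) + 3 / 2) := by positivity
  linarith

/-- Here `8/3 = 1 + 5/3`: the alternating sum is at most its first term, and the weights are
dominated by `1/(i+1)²`. -/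
lemma sum_diffWeight_le (k : ℕ) :
    |∑ i ∈ Finset.range k, (-1) ^ i * diffWeight k i| + ∑ i ∈ Finset.range k, diffWeight k i
      ≤ 8 / 3 := by
  obtain ⟨h0, h1⟩ := alternating_sum_bounds (antitone_diffWeight k) (diffWeight_nonneg k) k
  have h2 := diffWeight_le k 0
  have h3 := (Finset.sum_le_sum fun i (_ : i ∈ Finset.range k) => diffWeight_le k i).trans
    (sum_one_div_sq_le k)
  rw [abs_of_nonneg h0]
  norm_num at h2
  linarith

/-! ### Symmetric differences and their triangular averages. -/

/-- The symmetric difference `symmDifference m h f` as a continuous function. -/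
def symmDiffMap (m : ℕ) (f : C(Circ, ℂ)) (h : ℝ) : C(Circ, ℂ) :=
  ∑ i ∈ Finset.range (m + 1), ((-1 : ℂ) ^ (m - i) * (m.choose i : ℂ)) •
    shiftBy ((-((m : ℝ) / 2) * h + (i : ℝ) * h : ℝ) : Circ) f

lemma symmDiffMap_apply (m : ℕ) (f : C(Circ, ℂ)) (h : ℝ) (x : Circ) :
    symmDiffMap m f h x = symmDifference m h f x := by
  simp [symmDiffMap, symmDifference, ContinuousMap.sum_apply]

lemma continuous_symmDiffMap (m : ℕ) (f : C(Circ, ℂ)) : Continuous (symmDiffMap m f) := by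
  refine continuous_finsetSum _ fun i _ => ?_
  have hs : Continuous fun h : ℝ =>
      shiftBy ((-((m : ℝ) / 2) * h + (i : ℝ) * h : ℝ) : Circ) f :=
    (continuous_shiftBy f).comp ((AddCircle.continuous_mk' _).comp (by fun_prop))
  exact hs.const_smul ((-1 : ℂ) ^ (m - i) * (m.choose i : ℂ))

lemma bddAbove_symmDifference (m : ℕ) (f : C(Circ, ℂ)) (δ : ℝ) :
    BddAbove {r : ℝ | ∃ (x : Circ) (h : ℝ), |h| < δ ∧ r = ‖symmDifference m h f x‖} := by
  refine ⟨∑ i ∈ Finset.range (m + 1), ‖(-1 : ℂ) ^ (m - i) * (m.choose i : ℂ)‖ * ‖f‖, ?_⟩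
  rintro _ ⟨x, h, -, rfl⟩
  refine (norm_sum_le _ _).trans (Finset.sum_le_sum fun i _ => ?_)
  rw [norm_mul]
  exact mul_le_mul_of_nonneg_left (f.norm_coe_le_norm _) (norm_nonneg _)

lemma smoothnessModulus_nonneg (m : ℕ) (f : C(Circ, ℂ)) (δ : ℝ) :
    0 ≤ smoothnessModulus m f δ := by
  refine Real.sSup_nonneg ?_
  rintro _ ⟨x, h, -, rfl⟩
  exact norm_nonneg _

lemma norm_symmDiffMap_le (m : ℕ) (f : C(Circ, ℂ)) {h δ : ℝ} (hh : |h| < δ) :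
    ‖symmDiffMap m f h‖ ≤ smoothnessModulus m f δ := by
  refine (ContinuousMap.norm_le _ (smoothnessModulus_nonneg m f δ)).2 fun x => ?_
  rw [symmDiffMap_apply]
  exact le_csSup (bddAbove_symmDifference m f δ) ⟨x, h, hh, rfl⟩

lemma sum_range_two_mul_succ {E : Type*} [AddCommMonoid E] (g : ℕ → E) (k : ℕ) :
    ∑ i ∈ Finset.range (2 * k + 1), g i =
      g k + ∑ i ∈ Finset.range k, (g (k + 1 + i) + g (k - 1 - i)) := by
  rw [show 2 * k + 1 = (k + 1) + k by ring, Finset.sum_range_add, Finset.sum_range_succ,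
    Finset.sum_add_distrib, Finset.sum_range_reflect]
  abel

lemma fourier_coe_real (j : ℤ) (s : ℝ) :
    (fourier j (s : Circ) : ℂ) = Complex.exp ((((j : ℝ) * s : ℝ) : ℂ) * Complex.I) := by
  rw [fourier_coe_apply]
  congr 1
  have : (Real.pi : ℂ) ≠ 0 := by exact_mod_cast Real.pi_ne_zero
  push_cast
  field_simp

lemma fourier_add_fourier_neg (j : ℤ) (s : ℝ) :
    (fourier j (s : Circ) : ℂ) + fourier j ((-s : ℝ) : Circ) =
      ((2 * Real.cos (j * s) : ℝ) : ℂ) := by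
  rw [fourier_coe_real, fourier_coe_real]
  push_cast
  rw [Complex.two_cos]
  congr 2
  ring

/-- The Fourier multiplier of the symmetric difference of order `2 k`, normalized at frequency
zero. -/
def symmDiffSymbol (k : ℕ) (j : ℤ) (t : ℝ) : ℝ :=
  1 + 2 * ∑ i ∈ Finset.range k, (-1) ^ (i + 1) *
    (((2 * k).choose (k + i + 1) : ℝ) / ((2 * k).choose k : ℝ)) * Real.cos (j * ((i + 1) * t))

lemma coeffFunctional_symmDiffMap (k : ℕ) (f : C(Circ, ℂ)) (t : ℝ) (j : ℤ) :
    coeffFunctional j (symmDiffMap (2 * k) f t) =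
      (((-1) ^ k * ((2 * k).choose k : ℝ) * symmDiffSymbol k j t : ℝ) : ℂ) *
        coeffFunctional j f := by
  have hB : ((2 * k).choose k : ℂ) ≠ 0 := by
    exact_mod_cast (Nat.choose_pos (by omega : k ≤ 2 * k)).ne'
  simp only [symmDiffMap, map_sum, map_smul, coeffFunctional_shiftBy, smul_eq_mul, ← mul_assoc]
  rw [← Finset.sum_mul, sum_range_two_mul_succ]
  congr 1
  have hpair : ∀ i ∈ Finset.range k,
      ((-1 : ℂ) ^ (2 * k - (k + 1 + i)) * ((2 * k).choose (k + 1 + i) : ℂ) *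
        fourier j ((-(((2 * k : ℕ) : ℝ) / 2) * t + ((k + 1 + i : ℕ) : ℝ) * t : ℝ) : Circ) +
      (-1 : ℂ) ^ (2 * k - (k - 1 - i)) * ((2 * k).choose (k - 1 - i) : ℂ) *
        fourier j ((-(((2 * k : ℕ) : ℝ) / 2) * t + ((k - 1 - i : ℕ) : ℝ) * t : ℝ) : Circ)) =
      (-1) ^ k * ((2 * k).choose k : ℂ) * (2 * ((-1) ^ (i + 1) *
        (((2 * k).choose (k + i + 1) : ℂ) / ((2 * k).choose k : ℂ)) *
          (Real.cos (j * ((i + 1) * t)) : ℂ))) := by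
    intro i hi
    obtain ⟨d, rfl⟩ : ∃ d, k = i + 1 + d := ⟨k - (i + 1), by
      have := Finset.mem_range.1 hi; omega⟩
    have hc : (2 * (i + 1 + d)).choose (i + 1 + d - 1 - i) =
        (2 * (i + 1 + d)).choose (i + 1 + d + i + 1) :=
      Nat.choose_symm_of_eq_add (by omega)
    have h1 : (-(((2 * (i + 1 + d) : ℕ) : ℝ) / 2) * t + ((i + 1 + d + 1 + i : ℕ) : ℝ) * t) =
        (i + 1) * t := by push_cast; ring
    have h2 : (-(((2 * (i + 1 + d) : ℕ) : ℝ) / 2) * t + ((i + 1 + d - 1 - i : ℕ) : ℝ) * t) =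
        -((i + 1) * t) := by
      rw [show i + 1 + d - 1 - i = d by omega]; push_cast; ring
    have h3 : (-1 : ℂ) ^ (2 * (i + 1 + d) - (i + 1 + d + 1 + i)) = (-1) ^ d := by
      congr 1; omega
    have h4 : (-1 : ℂ) ^ (2 * (i + 1 + d) - (i + 1 + d - 1 - i)) = (-1) ^ d := by
      rw [show 2 * (i + 1 + d) - (i + 1 + d - 1 - i) = 2 * (i + 1) + d by omega, pow_add,
        pow_mul]
      simp
    have h5 : (-1 : ℂ) ^ (i + 1 + d) * (-1) ^ (i + 1) = (-1) ^ d := by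
      rw [← pow_add, show i + 1 + d + (i + 1) = 2 * (i + 1) + d by ring, pow_add, pow_mul]
      simp
    rw [hc, h1, h2, h3, h4, show i + 1 + d + 1 + i = i + 1 + d + i + 1 by ring]
    have h6 := fourier_add_fourier_neg j ((i + 1) * t)
    rw [← mul_add, h6, ← h5]
    push_cast at hB ⊢
    field_simp
  rw [Finset.sum_congr rfl hpair]
  have h0 : (-(((2 * k : ℕ) : ℝ) / 2) * t + (k : ℝ) * t) = 0 := by push_cast; ring
  rw [h0, show 2 * k - k = k by omega, symmDiffSymbol, ← Finset.mul_sum, ← Finset.mul_sum]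
  push_cast
  rw [fourier_eval_zero]
  ring

/-- The Cesàro-type average of the normalized symmetric differences of order `2 k`. -/
def averagedDiff (k : ℕ) (h : ℝ) (f : C(Circ, ℂ)) : C(Circ, ℂ) :=
  (((-1) ^ k / ((2 * k).choose k : ℝ) : ℝ) : ℂ) •
    ∫ t in (0 : ℝ)..h, ((2 / h * (1 - t / h) : ℝ) : ℂ) • symmDiffMap (2 * k) f t

lemma integral_triangle {h : ℝ} (hh : 0 < h) : ∫ t in (0 : ℝ)..h, 2 / h * (1 - t / h) = 1 := by
  have hd (t : ℝ) : HasDerivAt (fun t => 2 / h * (t - t ^ 2 / 2 / h)) (2 / h * (1 - t / h)) t := by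
    refine ((hasDerivAt_id t).sub
      ((((hasDerivAt_pow 2 t).div_const 2).div_const h))).const_mul (2 / h) |>.congr_deriv ?_
    simp
  rw [intervalIntegral.integral_eq_sub_of_hasDerivAt (fun t _ => hd t)
    ((by fun_prop : Continuous fun t : ℝ => 2 / h * (1 - t / h)).intervalIntegrable _ _)]
  field_simp
  ring

/-- The triangular weight is the source of the decay `1/j²`; a uniform weight would give only
`1/|j|`. -/
lemma integral_triangle_mul_cos {h r : ℝ} (hh : 0 < h) (hr : r ≠ 0) :
    ∫ t in (0 : ℝ)..h, 2 / h * (1 - t / h) * Real.cos (r * t) =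
      2 / h ^ 2 * ((1 - Real.cos (r * h)) / r ^ 2) := by
  have hd (t : ℝ) : HasDerivAt
      (fun t => 2 / h * ((1 - t / h) * (Real.sin (r * t) / r) - Real.cos (r * t) / (r ^ 2 * h)))
      (2 / h * (1 - t / h) * Real.cos (r * t)) t := by
    have h0 : HasDerivAt (fun t : ℝ => r * t) r t := by
      simpa using (hasDerivAt_id t).const_mul r
    have h1 : HasDerivAt (fun t : ℝ => 1 - t / h) (-(1 / h)) t := by
      simpa using ((hasDerivAt_id t).div_const h).const_sub 1
    refine (((h1.mul (h0.sin.div_const r)).sub (h0.cos.div_const (r ^ 2 * h))).const_mul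
      (2 / h)).congr_deriv ?_
    field_simp
    ring
  rw [intervalIntegral.integral_eq_sub_of_hasDerivAt (fun t _ => hd t)
    ((by fun_prop : Continuous fun t : ℝ =>
      2 / h * (1 - t / h) * Real.cos (r * t)).intervalIntegrable _ _)]
  simp only [mul_zero, Real.sin_zero, Real.cos_zero]
  field_simp
  ring

lemma norm_averagedDiff_le (k : ℕ) {h : ℝ} (hh : 0 < h) (f : C(Circ, ℂ)) :
    ‖averagedDiff k h f‖ ≤ smoothnessModulus (2 * k) f h / ((2 * k).choose k : ℝ) := by
  have hI : ‖∫ t in (0 : ℝ)..h, ((2 / h * (1 - t / h) : ℝ) : ℂ) • symmDiffMap (2 * k) f t‖ ≤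
      smoothnessModulus (2 * k) f h := by
    have hb : ∀ᵐ t : ℝ, t ∈ Set.Ioc 0 h →
        ‖((2 / h * (1 - t / h) : ℝ) : ℂ) • symmDiffMap (2 * k) f t‖ ≤
          2 / h * (1 - t / h) * smoothnessModulus (2 * k) f h := by
      refine .of_forall fun t ht => ?_
      have hnn : 0 ≤ 1 - t / h := by
        rw [sub_nonneg, div_le_one hh]; exact ht.2
      rw [norm_smul, Complex.norm_real, Real.norm_of_nonneg (by positivity)]
      -- The modulus only admits steps strictly below `h`; at `t = h` the weight vanishes.
      rcases ht.2.eq_or_lt with rfl | hlt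
      · simp [hh.ne']
      · gcongr
        exact norm_symmDiffMap_le _ _ (by rwa [abs_of_pos ht.1])
    refine (intervalIntegral.norm_integral_le_of_norm_le hh.le hb
      ((by fun_prop : Continuous fun t : ℝ =>
        2 / h * (1 - t / h) * smoothnessModulus (2 * k) f h).intervalIntegrable _ _)).trans ?_
    rw [intervalIntegral.integral_mul_const, integral_triangle hh, one_mul]
  rw [averagedDiff, norm_smul, Complex.norm_real, norm_div, norm_pow, norm_neg, norm_one, one_pow,
    Real.norm_natCast, one_div, inv_mul_eq_div]
  gcongr

lemma coeffFunctional_averagedDiff (k : ℕ) {h : ℝ} (hh : 0 < h) (f : C(Circ, ℂ)) {j : ℤ}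
    (hj : j ≠ 0) :
    coeffFunctional j (averagedDiff k h f) =
      ((1 - 4 / h ^ 2 * ∑ i ∈ Finset.range k, (-1) ^ i * diffWeight k i *
        ((1 - Real.cos (j * ((i + 1) * h))) / (j : ℝ) ^ 2) : ℝ) : ℂ) * coeffFunctional j f := by
  have hB : ((2 * k).choose k : ℝ) ≠ 0 := by
    exact_mod_cast (Nat.choose_pos (by omega : k ≤ 2 * k)).ne'
  have hj' : (j : ℝ) ≠ 0 := by exact_mod_cast hj
  have hsym : ∫ t in (0 : ℝ)..h, 2 / h * (1 - t / h) * symmDiffSymbol k j t =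
      1 - 4 / h ^ 2 * ∑ i ∈ Finset.range k, (-1) ^ i * diffWeight k i *
        ((1 - Real.cos (j * ((i + 1) * h))) / (j : ℝ) ^ 2) := by
    have e (t : ℝ) : 2 / h * (1 - t / h) * symmDiffSymbol k j t = 2 / h * (1 - t / h) +
        ∑ i ∈ Finset.range k, 2 * ((-1) ^ (i + 1) *
          (((2 * k).choose (k + i + 1) : ℝ) / ((2 * k).choose k : ℝ))) *
          (2 / h * (1 - t / h) * Real.cos (j * (i + 1) * t)) := by
      rw [symmDiffSymbol, mul_add, mul_one, Finset.mul_sum, Finset.mul_sum]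
      congr 1
      refine Finset.sum_congr rfl fun i _ => ?_
      rw [mul_assoc (j : ℝ)]
      ring
    simp only [e]
    rw [intervalIntegral.integral_add
      ((by fun_prop : Continuous _).intervalIntegrable _ _)
      ((by fun_prop : Continuous _).intervalIntegrable _ _), integral_triangle hh,
      intervalIntegral.integral_finsetSum
        fun i _ => (by fun_prop : Continuous _).intervalIntegrable _ _, sub_eq_add_neg,
      Finset.mul_sum, ← Finset.sum_neg_distrib]
    congr 1
    refine Finset.sum_congr rfl fun i _ => ?_
    have hi : (i : ℝ) + 1 ≠ 0 := by positivity
    rw [intervalIntegral.integral_const_mul,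
      integral_triangle_mul_cos hh (mul_ne_zero hj' hi), diffWeight, mul_assoc (j : ℝ)]
    field_simp
    ring
  have hc : Continuous fun t : ℝ => ((2 / h * (1 - t / h) : ℝ) : ℂ) • symmDiffMap (2 * k) f t :=
    (Complex.continuous_ofReal.comp (by fun_prop)).smul (continuous_symmDiffMap _ f)
  rw [averagedDiff, map_smul,
    ← ContinuousLinearMap.intervalIntegral_comp_comm _ (hc.intervalIntegrable _ _), ← hsym]
  have e (t : ℝ) : coeffFunctional j
      (((2 / h * (1 - t / h) : ℝ) : ℂ) • symmDiffMap (2 * k) f t) =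
      (((-1) ^ k * ((2 * k).choose k : ℝ)) : ℝ) *
        (((2 / h * (1 - t / h) * symmDiffSymbol k j t : ℝ) : ℂ) * coeffFunctional j f) := by
    rw [map_smul, coeffFunctional_symmDiffMap, smul_eq_mul]
    push_cast
    ring
  simp only [e]
  rw [intervalIntegral.integral_const_mul, intervalIntegral.integral_mul_const,
    intervalIntegral.integral_ofReal, smul_eq_mul, ← mul_assoc, ← mul_assoc,
    ← Complex.ofReal_mul]
  have h1 : (-1 : ℝ) ^ k / ((2 * k).choose k : ℝ) * ((-1) ^ k * ((2 * k).choose k : ℝ)) = 1 := by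
    field_simp
    rw [← pow_mul, mul_comm, pow_mul]
    simp
  rw [h1]
  simp

/-! ### The complementary operator and the self-bounding inequality. -/

/-- The operator which, on the frequencies `|j| > n`, is complementary to `averagedDiff k h`. -/
def smoothPart (k n : ℕ) (h : ℝ) (f : C(Circ, ℂ)) : C(Circ, ℂ) :=
  ∑ i ∈ Finset.range k, ((4 / h ^ 2 * ((-1) ^ i * diffWeight k i) : ℝ) : ℂ) •
    (invSqMultiplier n f - (1 / 2 : ℂ) •
      (shiftBy (((i + 1) * h : ℝ) : Circ) (invSqMultiplier n f) +
        shiftBy ((-((i + 1) * h) : ℝ) : Circ) (invSqMultiplier n f)))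

lemma coeffFunctional_smoothPart (k : ℕ) {n : ℕ} (h : ℝ) (f : C(Circ, ℂ)) {j : ℤ}
    (hj : (n : ℤ) < |j|) :
    coeffFunctional j (smoothPart k n h f) =
      ((4 / h ^ 2 * ∑ i ∈ Finset.range k, (-1) ^ i * diffWeight k i *
        ((1 - Real.cos (j * ((i + 1) * h))) / (j : ℝ) ^ 2) : ℝ) : ℂ) * coeffFunctional j f := by
  rw [smoothPart, map_sum, Finset.mul_sum, Complex.ofReal_sum, Finset.sum_mul]
  refine Finset.sum_congr rfl fun i _ => ?_
  rw [map_smul, map_sub, map_smul, map_add, coeffFunctional_shiftBy, coeffFunctional_shiftBy,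
    ← add_mul, fourier_add_fourier_neg, coeffFunctional_invSqMultiplier f hj]
  simp only [smul_eq_mul]
  push_cast
  ring

/-- The multiples of `g` are collected with their signs before taking norms, so cancellation gives
`1 + 5/3`. Termwise estimates would give `10/3`, hence `40/(hn)²`, which exceeds `1` for large `k`
at the step used in the theorem. -/
lemma norm_smoothPart_le (k n : ℕ) (h : ℝ) (f : C(Circ, ℂ)) :
    ‖smoothPart k n h f‖ ≤ 4 / h ^ 2 * (8 / 3) * ‖invSqMultiplier n f‖ := by
  set g := invSqMultiplier n f
  have e : smoothPart k n h f =
      ((4 / h ^ 2 * ∑ i ∈ Finset.range k, (-1) ^ i * diffWeight k i : ℝ) : ℂ) • g -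
        ∑ i ∈ Finset.range k, ((4 / h ^ 2 * ((-1) ^ i * diffWeight k i) : ℝ) : ℂ) •
          ((1 / 2 : ℂ) • (shiftBy (((i + 1) * h : ℝ) : Circ) g +
            shiftBy ((-((i + 1) * h) : ℝ) : Circ) g)) := by
    rw [smoothPart, Finset.mul_sum, Complex.ofReal_sum, Finset.sum_smul,
      ← Finset.sum_sub_distrib]
    exact Finset.sum_congr rfl fun i _ => smul_sub _ _ _
  have hh : 0 ≤ 4 / h ^ 2 := by positivity
  have h1 : ‖((4 / h ^ 2 * ∑ i ∈ Finset.range k, (-1) ^ i * diffWeight k i : ℝ) : ℂ) • g‖ =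
      4 / h ^ 2 * |∑ i ∈ Finset.range k, (-1) ^ i * diffWeight k i| * ‖g‖ := by
    rw [norm_smul, Complex.norm_real, Real.norm_eq_abs, abs_mul, abs_of_nonneg hh]
  have h2 : ‖∑ i ∈ Finset.range k, ((4 / h ^ 2 * ((-1) ^ i * diffWeight k i) : ℝ) : ℂ) •
          ((1 / 2 : ℂ) • (shiftBy (((i + 1) * h : ℝ) : Circ) g +
            shiftBy ((-((i + 1) * h) : ℝ) : Circ) g))‖ ≤
      4 / h ^ 2 * (∑ i ∈ Finset.range k, diffWeight k i) * ‖g‖ := by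
    rw [Finset.mul_sum, Finset.sum_mul]
    refine norm_sum_le_of_le _ fun i _ => ?_
    rw [norm_smul, Complex.norm_real, Real.norm_eq_abs, abs_mul, abs_mul, abs_of_nonneg hh,
      abs_pow, abs_neg, abs_one, one_pow, one_mul, abs_of_nonneg (diffWeight_nonneg k i)]
    refine mul_le_mul_of_nonneg_left ?_ (mul_nonneg hh (diffWeight_nonneg k i))
    have h3 := (norm_add_le (shiftBy (((i + 1) * h : ℝ) : Circ) g)
      (shiftBy ((-((i + 1) * h) : ℝ) : Circ) g)).trans
        (add_le_add (norm_shiftBy_le _ g) (norm_shiftBy_le _ g))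
    rw [norm_smul, show ‖(1 / 2 : ℂ)‖ = 1 / 2 by norm_num]
    linarith
  rw [e]
  refine (norm_sub_le _ _).trans ?_
  have h4 := mul_le_mul_of_nonneg_right
    (mul_le_mul_of_nonneg_left (sum_diffWeight_le k) hh) (norm_nonneg g)
  rw [mul_add, add_mul] at h4
  linarith

/-- Beyond degree `n` the two multipliers add up to `1`, and `τ` has no coefficients there. -/
lemma sub_averagedDiff_sub_smoothPart_mem (k : ℕ) {n : ℕ} {h : ℝ} (hh : 0 < h)
    (f : C(Circ, ℂ)) {τ : C(Circ, ℂ)} (hτ : τ ∈ trigPoly n) :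
    f - averagedDiff k h f - smoothPart k n h (f - τ) ∈ trigPoly n := by
  refine mem_trigPoly_of_coeffFunctional_eq_zero fun j hj => ?_
  have hj0 : j ≠ 0 := by
    rintro rfl
    simp at hj
    omega
  rw [map_sub, map_sub, coeffFunctional_averagedDiff k hh f hj0,
    coeffFunctional_smoothPart k h _ hj, map_sub, coeffFunctional_eq_zero_of_mem_trigPoly hτ hj]
  push_cast
  ring

lemma bestApprox_nonneg (n : ℕ) (f : C(Circ, ℂ)) : 0 ≤ bestApprox n f :=
  Real.iInf_nonneg fun _ => norm_nonneg _

lemma bestApprox_le {n : ℕ} (f : C(Circ, ℂ)) {τ : C(Circ, ℂ)} (hτ : τ ∈ trigPoly n) :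
    bestApprox n f ≤ ‖f - τ‖ :=
  ciInf_le (f := fun τ : trigPoly n => ‖f - (τ : C(Circ, ℂ))‖)
    ⟨0, by rintro _ ⟨σ, rfl⟩; exact norm_nonneg _⟩ ⟨τ, hτ⟩

lemma bestApprox_le_add_mul {k n : ℕ} (hn : 0 < n) {h : ℝ} (hh : 0 < h) (f : C(Circ, ℂ)) :
    bestApprox n f ≤ smoothnessModulus (2 * k) f h / ((2 * k).choose k : ℝ) +
      32 / (h * n) ^ 2 * bestApprox n f := by
  have hc : (0 : ℝ) ≤ 32 / (h * n) ^ 2 := by positivity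
  rw [← sub_le_iff_le_add']
  -- With the factor moved inside the infimum, it suffices to treat each `τ`; no best approximant is
  -- needed.
  conv_rhs => rw [bestApprox, Real.mul_iInf_of_nonneg hc]
  refine le_ciInf fun τ => ?_
  rw [sub_le_iff_le_add']
  refine (bestApprox_le f (sub_averagedDiff_sub_smoothPart_mem k hh f τ.2)).trans ?_
  have e : f - (f - averagedDiff k h f - smoothPart k n h (f - τ)) =
      averagedDiff k h f + smoothPart k n h (f - τ) := by abel
  rw [e]
  refine (norm_add_le _ _).trans (add_le_add (norm_averagedDiff_le k hh f) ?_)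
  refine (norm_smoothPart_le k n h _).trans ?_
  refine (mul_le_mul_of_nonneg_left (norm_invSqMultiplier_le hn _) (by positivity)).trans_eq ?_
  have : (n : ℝ) ≠ 0 := by exact_mod_cast hn.ne'
  field_simp
  ring

/-- The choice of `h` gives `(hn)² = (3π⁴/8)(1 + 1/k)² ≥ 32(1 + 1/k)²`, so the factor is at most
`k²/(k+1)²`. Its gap from `1` is `(2k+1)/(k+1)²`, more than required. -/
lemma contraction_factor_le {k n : ℕ} (hk : 1 ≤ k) (hn : 0 < n) :
    32 / (2 * Real.pi / (n : ℝ) * alphaConst * (1 + 1 / (k : ℝ)) * n) ^ 2 ≤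
      1 - 1 / (2 * ((k : ℝ) + 1) ^ 2) := by
  have hn' : (n : ℝ) ≠ 0 := by exact_mod_cast hn.ne'
  have hk' : (1 : ℝ) ≤ k := by exact_mod_cast hk
  have hk0 : (0 : ℝ) < k := by linarith
  -- Equivalent to `32 ≤ 3π⁴/8`.
  have hpi : (256 / 3 : ℝ) ≤ Real.pi ^ 4 := by
    have h9 : (9.6 : ℝ) ≤ Real.pi ^ 2 := by nlinarith [Real.pi_gt_d2]
    nlinarith
  have e : (2 * Real.pi / (n : ℝ) * alphaConst * (1 + 1 / (k : ℝ)) * n) ^ 2 =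
      3 * Real.pi ^ 4 / 8 * (((k : ℝ) + 1) ^ 2 / k ^ 2) := by
    have : 2 * Real.pi / (n : ℝ) * alphaConst * (1 + 1 / (k : ℝ)) * n =
        2 * Real.pi * alphaConst * ((k + 1) / k) := by
      field_simp
    rw [this, mul_pow, mul_pow, alphaConst_sq]
    ring
  calc 32 / (2 * Real.pi / (n : ℝ) * alphaConst * (1 + 1 / (k : ℝ)) * n) ^ 2
      ≤ 32 / (32 * (((k : ℝ) + 1) ^ 2 / k ^ 2)) := by
        rw [e]
        gcongr
        linarith
    _ = (k : ℝ) ^ 2 / (k + 1) ^ 2 := by field_simp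
    _ ≤ 1 - 1 / (2 * ((k : ℝ) + 1) ^ 2) := by
        rw [div_le_iff₀ (by positivity)]
        field_simp
        nlinarith

lemma bestApprox_le_jacksonConst_mul (f : C(Circ, ℂ)) {k n : ℕ} (hk : 1 ≤ k) (hn : 0 < n) :
    bestApprox n f ≤ jacksonConst k * smoothnessModulus (2 * k) f
      (2 * Real.pi / (n : ℝ) * alphaConst * (1 + 1 / (k : ℝ))) := by
  have hn' : (0 : ℝ) < n := by exact_mod_cast hn
  have hα := alphaConst_pos
  have h1 := bestApprox_le_add_mul (k := k) hn
    (by positivity : 0 < 2 * Real.pi / (n : ℝ) * alphaConst * (1 + 1 / (k : ℝ))) f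
  have h2 := mul_le_mul_of_nonneg_right (contraction_factor_le hk hn) (bestApprox_nonneg n f)
  set ω := smoothnessModulus (2 * k) f
      (2 * Real.pi / (n : ℝ) * alphaConst * (1 + 1 / (k : ℝ)))
  have h3 : 1 / (2 * ((k : ℝ) + 1) ^ 2) * bestApprox n f ≤ ω / ((2 * k).choose k : ℝ) := by
    linarith
  rw [one_div_mul_eq_div, div_le_iff₀ (by positivity)] at h3
  refine h3.trans_eq ?_
  rw [jacksonConst]
  ring

end

theorem theorem1 :
    alphaConst < 1 ∧
    (∀ (f : C(Circ, ℂ)) (k n : ℕ), 1 ≤ k → 2 * k ≤ n →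
      bestApprox n f ≤
        jacksonConst k *
          smoothnessModulus (2 * k) f
            (2 * Real.pi / (n : ℝ) * alphaConst * (1 + 1 / (k : ℝ)))) ∧
    (∃ C : ℝ, ∀ k : ℕ, 1 ≤ k →
      jacksonConst k ≤ C * (k : ℝ) ^ ((5 : ℝ) / 2) * (2 : ℝ) ^ (-(2 * (k : ℝ)))) :=
  ⟨alphaConst_lt_one, fun f _ _ hk hn => bestApprox_le_jacksonConst_mul f hk (by omega),
    16, fun _ hk => jacksonConst_le hk⟩
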